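/- **Definitions.** A *semigroupoid* is a set $S$ with a subset $S^{(2)}\subseteq S\times S$ and a product $S^{(2)}\to S$, $(f,g)\mapsto fg$, such that whenever $(f,g),(g,h)\in S^{(2)}$, or $(f,g),(fg,h)\in S^{(2)}$, or $(g,h),(f,gh)\in S^{(2)}$, all of $(f,g),(g,h),(fg,h),(f,gh)$ lie in $S^{(2)}$ and $(fg)h=f(gh)$. Write $f\mid g$ if $f=g$ or $g=fh$ for some $h$ with $(f,h)\in S^{(2)}$; $f$ and $g$ *intersect* if they have a common multiple $m$ (that is, $f\mid m$ and $g\mid m$). Let $\tilde S=S\sqcup\{1\}$, $S^f=\{g\in S:(f,g)\in S^{(2)}\}$ for $f\in S$, and $S^1=S$. A subset $H\subseteq X\subseteq S$ is a *covering* of $X$ if each element of $X$ intersects some element of $H$. A *representation* of $S$ in a unital C*-algebra $B$ is a map $f\mapsto T_f$ from $S$ to the partial isometries of $B$ with $T_fT_g=T_{fg}$ if $(f,g)\in S^{(2)}$ and $T_fT_g=0$ otherwise, such that the projections $Q_f=T_f^*T_f$ and $P_f=T_fT_f^*$ ($f\in S$) all commute with one another, $P_fP_g=0$ if $f,g$ do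 not intersect, and $Q_fP_g=P_g$ if $(f,g)\in S^{(2)}$; put $Q_1=1$. It is *tight* if for all finite $F,G\subseteq\tilde S$ and every finite covering $H$ of $\bigcap_{f\in F}S^f\cap\bigcap_{g\in G}(S\setminus S^g)$ one has $\bigvee_{h\in H}P_h=\prod_{f\in F}Q_f\prod_{g\in G}(1-Q_g)$, where $P\vee P'=P+P'-PP'$ for commuting projections. Let $\tilde{\mathcal O}(S)$ be the universal unital C*-algebra generated by a tight representation $\hat s$ of $S$; the *semigroupoid C*-algebra* $\mathcal O(S)$ is the closed *-subalgebra of $\tilde{\mathcal O}(S)$ generated by $\{\hat s_f:f\in S\}$. The morphisms of a small category form a semigroupoid, in which $fg=f\circ g$ is defined if and only if the domain $s(f)$ equals the co-domain $r(g)$. Let $k\ge 0$. A *$k$-graph* is a small category $\Lambda$, identified with its set of morphisms, with objects identified with their identity morphisms, together with a functor $d:\Lambda\to\mathbb N^k$ such that whenever $d(f)=m+n$ there is a unique pair $(g,h)$ with $f=gh$, $d(g)=m$ and $d(h)=n$. For an object $v$ and $n\in\mathbb N^k$ let $\Lambda^v_n=\{f\in\Lambda:r(f)=v,\ d(f)=n\}$.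 If $0<|\Lambda^v_n|<\infty$ for all $v$ and $n$ (the $k$-graph is row-finite and has no sources), the Kumjian–Pask algebra $C^*(\Lambda)=C^*(\Lambda,d)$ is the universal C*-algebra generated by partial isometries $\check s_f$, $f\in\Lambda$, such that (i) the $\check s_v$, for objects $v$, are mutually orthogonal projections; (ii) $\check s_{fg}=\check s_f\check s_g$ if $s(f)=r(g)$; (iii) $\check s_f^*\check s_f=\check s_{s(f)}$ for all $f$; (iv) $\check s_v=\sum_{f\in\Lambda^v_n}\check s_f\check s_f^*$ for all objects $v$ and all $n\in\mathbb N^k$. **Theorem.** Let $(\Lambda,d)$ be a $k$-graph such that $0<|\Lambda^v_n|<\infty$ for all objects $v$ and all $n\in\mathbb N^k$. Then $C^*(\Lambda)$ is *-isomorphic to the semigroupoid C*-algebra $\mathcal O(\Lambda)$ of the underlying category viewed as a semigroupoid, by an isomorphism that sends $\check s_f$ to $\hat s_f$ for every $f\in\Lambda$. Consequently $C^*(\Lambda)$ does not depend on the degree functor: if $d':\Lambda\to\mathbb N^{l}$, for some $l\ge 0$, is another degree functor on the same category that makes it a row-finite $l$-graph without sources, then $C^*(\Lambda,d)\cong C^*(\Lambda,d')$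 by a *-isomorphism that sends canonical generators to canonical generators. -/

import Mathlib

open CategoryTheory
open scoped ENNReal

universe u v w

/-- `a` is a partial isometry: `a a* a = a`. -/
def IsPartialIsometry {B : Type*} [Mul B] [Star B] (a : B) : Prop :=
  a * star a * a = a

theorem IsPartialIsometry.norm_le_one {B : Type*} [NonUnitalCStarAlgebra B] {a : B}
    (ha : IsPartialIsometry a) : ‖a‖ ≤ 1 := by
  have h1 : (star a * a) * (star a * a) = star a * a := by
    have h : a * star a * a = a := ha
    calc (star a * a) * (star a * a) = star a * (a * star a * a) := by simp only [mul_assoc]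
      _ = star a * a := by rw [h]
  have h2 : star (star a * a) = star a * a := by simp
  have h3 : ‖star a * a‖ * ‖star a * a‖ = ‖star a * a‖ := by
    conv_rhs => rw [← h1]
    conv_rhs => rw [← h2]
    rw [h2]
    have := CStarRing.norm_star_mul_self (x := star a * a)
    rw [h2] at this
    exact this.symm
  have h4 : ‖star a * a‖ = ‖a‖ * ‖a‖ := CStarRing.norm_star_mul_self
  rw [h4] at h3
  by_contra! hlt
  nlinarith [mul_pos (zero_lt_one.trans hlt) (zero_lt_one.trans hlt),
    mul_lt_mul'' hlt hlt zero_le_one zero_le_one]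

/-! ### Semigroupoids -/

/-- A semigroupoid: a set `S` with a set of composable pairs and an associative partial product. -/
class Semigroupoid (S : Type u) where
  /-- `Composable f g` says that `(f, g)` belongs to the set `S⁽²⁾` of composable pairs. -/
  Composable : S → S → Prop
  /-- The product `fg` of a composable pair. -/
  mul : ∀ f g : S, Composable f g → S
  assoc : ∀ f g h : S,
    ((Composable f g ∧ Composable g h) ∨
      (∃ hfg : Composable f g, Composable (mul f g hfg) h) ∨
      (∃ hgh : Composable g h, Composable f (mul g h hgh))) →
    ∃ (hfg : Composable f g) (hgh : Composable g h)
      (h₁ : Composable (mul f g hfg) h) (h₂ : Composable f (mul g h hgh)),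
      mul (mul f g hfg) h h₁ = mul f (mul g h hgh) h₂

namespace Semigroupoid

variable {S : Type u} [Semigroupoid S]

/-- `f` divides `g`. -/
def Divides (f g : S) : Prop :=
  f = g ∨ ∃ (h : S) (hc : Composable f h), mul f h hc = g

/-- `f` and `g` intersect: they have a common multiple. -/
def Intersects (f g : S) : Prop := ∃ m : S, Divides f m ∧ Divides g m

/-- The set of all `g` such that `fg` is defined, for `f` in the unitization `S ∪ {1}`, which is
modelled by `Option S` with `none` in the role of `1`; it is all of `S` for `f = 1`. -/
def rightSet : Option S → Set S
  | none => Set.univ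
  | some f => {g | Composable f g}

/-- The elements of `S` that lie in `rightSet f` for all `f ∈ F` and in no `rightSet g`
for `g ∈ G`. -/
def cylinder (F G : Finset (Option S)) : Set S :=
  {h | (∀ f ∈ F, h ∈ rightSet f) ∧ ∀ g ∈ G, h ∉ rightSet g}

/-- `H` is a covering of `X`. -/
def IsCovering (H X : Set S) : Prop :=
  H ⊆ X ∧ ∀ f ∈ X, ∃ h ∈ H, Intersects h f

/-- A representation of a semigroupoid in a unital C*-algebra. -/
structure IsRepresentation {B : Type*} [CStarAlgebra B] (T : S → B) : Prop where
  partialIsometry : ∀ f, IsPartialIsometry (T f)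
  map_mul : ∀ f g (h : Composable f g), T f * T g = T (mul f g h)
  mul_eq_zero : ∀ f g, ¬ Composable f g → T f * T g = 0
  commute_initial_initial : ∀ f g, Commute (star (T f) * T f) (star (T g) * T g)
  commute_initial_final : ∀ f g, Commute (star (T f) * T f) (T g * star (T g))
  commute_final_final : ∀ f g, Commute (T f * star (T f)) (T g * star (T g))
  final_mul_final : ∀ f g, ¬ Intersects f g → (T f * star (T f)) * (T g * star (T g)) = 0
  initial_mul_final : ∀ f g, Composable f g →
    (star (T f) * T f) * (T g * star (T g)) = T g * star (T g)

/-- The initial projection of `T f`, for `f` in the unitization; it is `1` for `f = 1`. -/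
def initialProj {B : Type*} [CStarAlgebra B] (T : S → B) : Option S → B
  | none => 1
  | some f => star (T f) * T f

/-- The join of a finite list of commuting projections, where `p ∨ q = p + q - p q`. -/
def joinList {B : Type*} [Ring B] : List B → B
  | [] => 0
  | p :: l => p + joinList l - p * joinList l

/-- A tight representation. All the projections involved commute, so that the order in which
`Finset.toList` lists the members of a finite set has no influence on the products and joins. -/
structure IsTightRepresentation {B : Type*} [CStarAlgebra B] (T : S → B) : Prop
    extends IsRepresentation T where
  tight : ∀ (F G : Finset (Option S)) (H : Finset S), IsCovering (H : Set S) (cylinder F G) →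
    joinList (H.toList.map fun h => T h * star (T h)) =
      (F.toList.map fun f => initialProj T f).prod *
        (G.toList.map fun g => 1 - initialProj T g).prod

end Semigroupoid

/-! ### Universal C*-algebras

The universal C*-algebra generated by partial isometries subject to relations is realized inside
the C*-algebra of bounded families `lp _ ∞` indexed by *all* families in C*-algebras that satisfy
the relations, as the C*-subalgebra generated by the tautological family. Its norm is thus the
supremum of the norms in all the families that satisfy the relations. The universe `w` is arbitrary,
so that there is no bound on the size of the C*-algebras that are taken into account. -/

/-- The closed *-subalgebra, not necessarily unital, generated by a set. -/
noncomputable def closedAdjoin {B : Type*} [NonUnitalCStarAlgebra B] (s : Set B) :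
    NonUnitalStarSubalgebra ℂ B :=
  (NonUnitalStarAlgebra.adjoin ℂ s).topologicalClosure

theorem isClosed_closedAdjoin {B : Type*} [NonUnitalCStarAlgebra B] (s : Set B) :
    IsClosed (closedAdjoin s : Set B) :=
  NonUnitalStarSubalgebra.isClosed_topologicalClosure _

theorem subset_closedAdjoin {B : Type*} [NonUnitalCStarAlgebra B] (s : Set B) :
    s ⊆ closedAdjoin s :=
  (NonUnitalStarAlgebra.subset_adjoin ℂ s).trans
    (NonUnitalStarSubalgebra.le_topologicalClosure _)

section Lp

variable {I : Type*} {A : I → Type*} [∀ i, Nontrivial (A i)] [∀ i, CStarAlgebra (A i)]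

noncomputable instance lpInftyCStarAlgebra : CStarAlgebra (lp A ∞) where

end Lp

/-- A tight representation of `S` in some nonzero unital C*-algebra. (The one in the zero algebra
would not contribute to a supremum of norms.) -/
structure TightRep (S : Type u) [Semigroupoid S] : Type (max u w + 1) where
  carrier : Type (max u w)
  [nontrivial : Nontrivial carrier]
  [cstar : CStarAlgebra carrier]
  toFun : S → carrier
  isTight : Semigroupoid.IsTightRepresentation toFun

attribute [instance] TightRep.nontrivial TightRep.cstar

section SemigroupoidAlgebra

variable (S : Type u) [Semigroupoid S]

/-- The family of all tight representations, evaluated at `f`. -/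
noncomputable def tightFamily (f : S) : lp (fun i : TightRep.{u, w} S => i.carrier) ∞ :=
  ⟨fun i => i.toFun f, memℓp_infty ⟨1, by
    rintro _ ⟨i, rfl⟩
    exact (i.isTight.partialIsometry f).norm_le_one⟩⟩

/-- The unital C*-subalgebra generated by the tautological family. -/
noncomputable def tightSubalgebra :
    StarSubalgebra ℂ (lp (fun i : TightRep.{u, w} S => i.carrier) ∞) :=
  (StarAlgebra.adjoin ℂ (Set.range (tightFamily.{u, w} S))).topologicalClosure

/-- The universal unital C*-algebra generated by a tight representation of `S`. -/
def UnitalSemigroupoidAlgebra : Type (max u w + 1) := tightSubalgebra.{u, w} S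

noncomputable instance : CStarAlgebra (UnitalSemigroupoidAlgebra.{u, w} S) :=
  StarSubalgebra.cstarAlgebra (tightSubalgebra.{u, w} S)
    (h_closed := StarSubalgebra.isClosed_topologicalClosure _)

/-- The universal tight representation. -/
noncomputable def universalTight (f : S) : UnitalSemigroupoidAlgebra.{u, w} S :=
  ⟨tightFamily.{u, w} S f,
    StarSubalgebra.le_topologicalClosure _ (StarAlgebra.subset_adjoin ℂ _ ⟨f, rfl⟩)⟩

/-- The closed *-subalgebra, not necessarily unital, that the range of the universal tight
representation generates. -/
noncomputable def semigroupoidSubalgebra :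
    NonUnitalStarSubalgebra ℂ (UnitalSemigroupoidAlgebra.{u, w} S) :=
  closedAdjoin (Set.range (universalTight.{u, w} S))

/-- The C*-algebra `𝒪(S)` of a semigroupoid. -/
def SemigroupoidAlgebra : Type (max u w + 1) := semigroupoidSubalgebra.{u, w} S

noncomputable instance : NonUnitalCStarAlgebra (SemigroupoidAlgebra.{u, w} S) :=
  NonUnitalStarSubalgebra.nonUnitalCStarAlgebra (semigroupoidSubalgebra.{u, w} S)
    (h_closed := isClosed_closedAdjoin _)

/-- The canonical generators of `𝒪(S)`. -/
noncomputable def SemigroupoidAlgebra.gen (f : S) : SemigroupoidAlgebra.{u, w} S :=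
  ⟨universalTight.{u, w} S f, subset_closedAdjoin _ ⟨f, rfl⟩⟩

end SemigroupoidAlgebra

/-! ### Categories as semigroupoids -/

/-- The set of all morphisms of a category. -/
@[ext]
structure Mor (C : Type u) [Category.{v} C] : Type (max u v) where
  /-- The domain. -/
  src : C
  /-- The co-domain. -/
  rng : C
  hom : src ⟶ rng

namespace Mor

variable {C : Type u} [Category.{v} C]

/-- The identity morphism of an object. -/
def id (x : C) : Mor C := ⟨x, x, 𝟙 x⟩

/-- The composition `fg = f ∘ g`, defined if the domain of `f` is the co-domain of `g`. -/
def comp (f g : Mor C) (h : f.src = g.rng) : Mor C :=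
  ⟨g.src, f.rng, g.hom ≫ eqToHom h.symm ≫ f.hom⟩

/-- The semigroupoid of all morphisms of a category. -/
instance : Semigroupoid (Mor C) where
  Composable f g := f.src = g.rng
  mul := comp
  assoc := by
    rintro ⟨a, b, f⟩ ⟨c, d, g⟩ ⟨e, e', h⟩ H
    have H' : a = d ∧ c = e' := by
      rcases H with H | ⟨h₁, h₂⟩ | ⟨h₁, h₂⟩
      · exact H
      · exact ⟨h₁, h₂⟩
      · exact ⟨h₂, h₁⟩
    obtain ⟨rfl, rfl⟩ := H'
    refine ⟨rfl, rfl, rfl, rfl, ?_⟩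
    change (⟨e, b, h ≫ 𝟙 c ≫ g ≫ 𝟙 a ≫ f⟩ : Mor C) = ⟨e, b, (h ≫ 𝟙 c ≫ g) ≫ 𝟙 a ≫ f⟩
    simp

end Mor

/-! ### Higher-rank graphs -/

/-- The structure of a `k`-graph on a category: a degree functor to the monoid `ℕᵏ` with the unique
factorization property. -/
structure KGraph (k : ℕ) (C : Type u) [Category.{v} C] where
  deg : Mor C → (Fin k → ℕ)
  deg_id : ∀ x : C, deg (Mor.id x) = 0
  deg_comp : ∀ (f g : Mor C) (h : f.src = g.rng), deg (f.comp g h) = deg f + deg g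
  factorization : ∀ (f : Mor C) (m n : Fin k → ℕ), deg f = m + n →
    ∃! p : Mor C × Mor C, deg p.1 = m ∧ deg p.2 = n ∧
      ∃ h : p.1.src = p.2.rng, p.1.comp p.2 h = f

namespace KGraph

variable {k : ℕ} {C : Type u} [Category.{v} C] (Λ : KGraph k C)

/-- The morphisms of degree `n` with co-domain `x`. -/
def paths (x : C) (n : Fin k → ℕ) : Set (Mor C) :=
  {f | f.rng = x ∧ Λ.deg f = n}

def RowFinite : Prop := ∀ x n, (Λ.paths x n).Finite

def NoSources : Prop := ∀ x n, (Λ.paths x n).Nonempty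

/-- A family of partial isometries in a C*-algebra, not necessarily unital, that satisfies the
defining relations of the C*-algebra of a `k`-graph. -/
structure IsKPFamily {B : Type*} [NonUnitalCStarAlgebra B] (T : Mor C → B) : Prop where
  partialIsometry : ∀ f, IsPartialIsometry (T f)
  projection : ∀ x : C, IsStarProjection (T (Mor.id x))
  orthogonal : ∀ x y : C, x ≠ y → T (Mor.id x) * T (Mor.id y) = 0
  map_comp : ∀ (f g : Mor C) (h : f.src = g.rng), T (f.comp g h) = T f * T g
  star_mul_self : ∀ f : Mor C, star (T f) * T f = T (Mor.id f.src)
  sum_final : ∀ (x : C) (n : Fin k → ℕ) (h : (Λ.paths x n).Finite),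
    T (Mor.id x) = ∑ f ∈ h.toFinset, T f * star (T f)

/-- A family in some C*-algebra that satisfies the defining relations. -/
structure KPFamily : Type (max u v w + 1) where
  carrier : Type (max u v w)
  [cstar : NonUnitalCStarAlgebra carrier]
  toFun : Mor C → carrier
  isKP : Λ.IsKPFamily toFun

attribute [instance] KPFamily.cstar

/-- The family of all families that satisfy the defining relations, evaluated at `f`. -/
noncomputable def kpFamily (f : Mor C) : lp (fun i : KPFamily.{u, v, w} Λ => i.carrier) ∞ :=
  ⟨fun i => i.toFun f, memℓp_infty ⟨1, by
    rintro _ ⟨i, rfl⟩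
    exact (i.isKP.partialIsometry f).norm_le_one⟩⟩

/-- The C*-subalgebra generated by the tautological family. -/
noncomputable def kpSubalgebra :
    NonUnitalStarSubalgebra ℂ (lp (fun i : KPFamily.{u, v, w} Λ => i.carrier) ∞) :=
  closedAdjoin (Set.range (kpFamily.{u, v, w} Λ))

/-- The C*-algebra `C*(Λ)` of a `k`-graph: the universal C*-algebra for the defining relations. -/
def GraphAlgebra : Type (max u v w + 1) := kpSubalgebra.{u, v, w} Λ

noncomputable instance : NonUnitalCStarAlgebra (GraphAlgebra.{u, v, w} Λ) :=
  NonUnitalStarSubalgebra.nonUnitalCStarAlgebra (kpSubalgebra.{u, v, w} Λ)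
    (h_closed := isClosed_closedAdjoin _)

/-- The canonical generators of `C*(Λ)`. -/
noncomputable def gen (f : Mor C) : GraphAlgebra.{u, v, w} Λ :=
  ⟨kpFamily.{u, v, w} Λ f, subset_closedAdjoin _ ⟨f, rfl⟩⟩

end KGraph

/-! ### The universal properties

The canonical generators satisfy the relations, and every family that satisfies the relations is the
image of the canonical generators under a unique homomorphism. -/

section UniversalProperty

open scoped CStarAlgebra

theorem joinList_map {A B : Type*} [Ring A] [Ring B] (φ : A →+* B) (l : List A) :
    φ (Semigroupoid.joinList l) = Semigroupoid.joinList (l.map φ) := by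
  induction l with
  | nil => simp [Semigroupoid.joinList]
  | cons a l ih => simp [Semigroupoid.joinList, ih]

variable (S : Type u) [Semigroupoid S]

/-- The evaluation at one tight representation. -/
noncomputable def evalTight (i : TightRep.{u, w} S) :
    UnitalSemigroupoidAlgebra.{u, w} S →⋆ₐ[ℂ] i.carrier where
  toFun x := x.1 i
  map_one' := rfl
  map_mul' _ _ := rfl
  map_zero' := rfl
  map_add' _ _ := rfl
  commutes' _ := rfl
  map_star' _ := rfl

theorem evalTight_ext {x y : UnitalSemigroupoidAlgebra.{u, w} S}
    (h : ∀ i, evalTight S i x = evalTight S i y) : x = y :=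
  Subtype.ext (lp.ext (funext h))

theorem evalTight_gen (i : TightRep.{u, w} S) (f : S) :
    evalTight S i (universalTight.{u, w} S f) = i.toFun f := rfl

theorem universalTight_isTight :
    Semigroupoid.IsTightRepresentation (universalTight.{u, w} S) where
  partialIsometry f := evalTight_ext S fun i => by
    simpa [evalTight_gen, map_star] using! i.isTight.partialIsometry f
  map_mul f g h := evalTight_ext S fun i => by
    simpa [evalTight_gen, map_star] using i.isTight.map_mul f g h
  mul_eq_zero f g h := evalTight_ext S fun i => by
    simpa [evalTight_gen, map_star] using i.isTight.mul_eq_zero f g h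
  commute_initial_initial f g := evalTight_ext S fun i => by
    simpa [evalTight_gen, map_star] using (i.isTight.commute_initial_initial f g).eq
  commute_initial_final f g := evalTight_ext S fun i => by
    simpa [evalTight_gen, map_star] using (i.isTight.commute_initial_final f g).eq
  commute_final_final f g := evalTight_ext S fun i => by
    simpa [evalTight_gen, map_star] using (i.isTight.commute_final_final f g).eq
  final_mul_final f g h := evalTight_ext S fun i => by
    simpa [evalTight_gen, map_star] using i.isTight.final_mul_final f g h
  initial_mul_final f g h := evalTight_ext S fun i => by
    simpa [evalTight_gen, map_star] using i.isTight.initial_mul_final f g h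
  tight F G H h := evalTight_ext S fun i => by
    have e : ∀ f, evalTight S i (Semigroupoid.initialProj (universalTight.{u, w} S) f)
        = Semigroupoid.initialProj i.toFun f := by
      rintro (_ | f)
      · exact map_one (evalTight S i)
      · simp [Semigroupoid.initialProj, evalTight_gen, map_star]
    have := joinList_map (evalTight S i : _ →+* i.carrier)
      (H.toList.map fun h => universalTight.{u, w} S h * star (universalTight.{u, w} S h))
    rw [RingHom.coe_coe] at this
    rw [this, map_mul, map_list_prod, map_list_prod]
    simpa [Function.comp_def, e, evalTight_gen, map_star] using i.isTight.tight F G H h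

/-- The universal property. -/
theorem existsUnique_lift_tight {B : Type (max u w)} [CStarAlgebra B] {T : S → B}
    (hT : Semigroupoid.IsTightRepresentation T) :
    ∃! φ : UnitalSemigroupoidAlgebra.{u, w} S →⋆ₐ[ℂ] B,
      ∀ f, φ (universalTight.{u, w} S f) = T f := by
  refine existsUnique_of_exists_of_unique ?_ ?_
  · rcases subsingleton_or_nontrivial B with hB | hB
    · exact ⟨{ toFun := fun _ => 0, map_one' := Subsingleton.elim _ _,
               map_mul' := fun _ _ => Subsingleton.elim _ _
               map_zero' := rfl, map_add' := fun _ _ => Subsingleton.elim _ _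
               commutes' := fun _ => Subsingleton.elim _ _
               map_star' := fun _ => Subsingleton.elim _ _ }, fun _ => Subsingleton.elim _ _⟩
    · exact ⟨evalTight S (TightRep.mk.{u, w} B T hT), fun f => rfl⟩
  · intro φ ψ hφ hψ
    have hc : ∀ χ : UnitalSemigroupoidAlgebra.{u, w} S →⋆ₐ[ℂ] B, Continuous χ :=
      fun χ => AddMonoidHomClass.continuous_of_bound χ 1
        (by simpa using! NonUnitalStarAlgHom.norm_apply_le χ)
    refine StarAlgHom.ext_topologicalClosure
      (S := StarAlgebra.adjoin ℂ (Set.range (tightFamily.{u, w} S)))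
      (hc φ) (hc ψ) ?_
    refine StarAlgHom.ext_adjoin ?_
    rintro ⟨_, hx⟩ ⟨f, rfl⟩
    exact (hφ f).trans (hψ f).symm

end UniversalProperty

namespace KGraph

open scoped CStarAlgebra

variable {k : ℕ} {C : Type u} [Category.{v} C] (Λ : KGraph k C)

/-- The evaluation at one family. -/
noncomputable def evalKP (i : KPFamily.{u, v, w} Λ) :
    GraphAlgebra.{u, v, w} Λ →⋆ₙₐ[ℂ] i.carrier where
  toFun x := x.1 i
  map_mul' _ _ := rfl
  map_zero' := rfl
  map_add' _ _ := rfl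
  map_smul' _ _ := rfl
  map_star' _ := rfl

theorem evalKP_ext {x y : GraphAlgebra.{u, v, w} Λ}
    (h : ∀ i, Λ.evalKP i x = Λ.evalKP i y) : x = y :=
  Subtype.ext (lp.ext (funext h))

theorem evalKP_gen (i : KPFamily.{u, v, w} Λ) (f : Mor C) :
    Λ.evalKP i (gen.{u, v, w} Λ f) = i.toFun f := rfl

theorem gen_isKP : Λ.IsKPFamily (gen.{u, v, w} Λ) where
  partialIsometry f := evalKP_ext Λ fun i => by
    simpa [evalKP_gen, map_star] using! i.isKP.partialIsometry f
  projection x := ⟨evalKP_ext Λ fun i => by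
      simpa [evalKP_gen, map_star] using (i.isKP.projection x).isIdempotentElem.eq,
    evalKP_ext Λ fun i => by
      simpa [evalKP_gen, map_star] using (i.isKP.projection x).isSelfAdjoint.star_eq⟩
  orthogonal x y h := evalKP_ext Λ fun i => by
    simpa [evalKP_gen, map_star] using i.isKP.orthogonal x y h
  map_comp f g h := evalKP_ext Λ fun i => by
    simpa [evalKP_gen, map_star] using i.isKP.map_comp f g h
  star_mul_self f := evalKP_ext Λ fun i => by
    simpa [evalKP_gen, map_star] using i.isKP.star_mul_self f
  sum_final x n h := evalKP_ext Λ fun i => by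
    simpa [evalKP_gen, map_star] using i.isKP.sum_final x n h

/-- The universal property. -/
theorem existsUnique_lift_KP {B : Type (max u v w)} [NonUnitalCStarAlgebra B] {T : Mor C → B}
    (hT : Λ.IsKPFamily T) :
    ∃! φ : GraphAlgebra.{u, v, w} Λ →⋆ₙₐ[ℂ] B, ∀ f, φ (gen.{u, v, w} Λ f) = T f := by
  refine existsUnique_of_exists_of_unique ⟨evalKP Λ (KPFamily.mk.{u, v, w} B T hT), fun f => rfl⟩ ?_
  intro φ ψ hφ hψ
  have hA : NonUnitalStarAlgebra.adjoin ℂ (Set.range (kpFamily.{u, v, w} Λ)) ≤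
      kpSubalgebra.{u, v, w} Λ := NonUnitalStarSubalgebra.le_topologicalClosure _
  have key : ∀ x (hx : x ∈ NonUnitalStarAlgebra.adjoin ℂ (Set.range (kpFamily.{u, v, w} Λ))),
      φ ⟨x, hA hx⟩ = ψ ⟨x, hA hx⟩ := by
    intro x hx
    induction hx using NonUnitalStarAlgebra.adjoin_induction with
    | mem x hx =>
      obtain ⟨f, rfl⟩ := hx
      exact (hφ f).trans (hψ f).symm
    | add x y hx hy h₁ h₂ =>
      have e (χ : GraphAlgebra.{u, v, w} Λ →⋆ₙₐ[ℂ] B) := map_add χ ⟨x, hA hx⟩ ⟨y, hA hy⟩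
      exact (e φ).trans ((congrArg₂ (· + ·) h₁ h₂).trans (e ψ).symm)
    | zero => exact (map_zero φ).trans (map_zero ψ).symm
    | mul x y hx hy h₁ h₂ =>
      have e (χ : GraphAlgebra.{u, v, w} Λ →⋆ₙₐ[ℂ] B) := map_mul χ ⟨x, hA hx⟩ ⟨y, hA hy⟩
      exact (e φ).trans ((congrArg₂ (· * ·) h₁ h₂).trans (e ψ).symm)
    | smul c x hx h =>
      have e (χ : GraphAlgebra.{u, v, w} Λ →⋆ₙₐ[ℂ] B) := map_smul χ c ⟨x, hA hx⟩
      exact (e φ).trans ((congrArg (c • ·) h).trans (e ψ).symm)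
    | star x hx h =>
      have e (χ : GraphAlgebra.{u, v, w} Λ →⋆ₙₐ[ℂ] B) := map_star χ ⟨x, hA hx⟩
      exact (e φ).trans ((congrArg star h).trans (e ψ).symm)
  have hd : DenseRange (Set.inclusion hA) := by
    refine (denseRange_inclusion_iff (SetLike.coe_subset_coe.mpr hA)).mpr ?_
    exact subset_rfl
  refine DFunLike.ext' (Continuous.ext_on hd (map_continuous φ) (map_continuous ψ) ?_)
  rintro _ ⟨⟨x, hx⟩, rfl⟩
  exact key x hx

end KGraph

/-!
In a row-finite `k`-graph without sources, two paths of the same degree have no common multiple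
unless they are equal, and the paths of degree `n` with co-domain `v` cover all paths with
co-domain `v`; hence tightness gives the relations of the graph algebra. Conversely, let the `T f`
satisfy these relations. If the degree of `μ` dominates that of `f`, then the final projection of
`T μ` lies under that of `T f` or is orthogonal to it, according to whether `f` divides `μ`. After
multiplication by `T v`, which is the sum of the final projections of all `T μ` with `μ` in
`Λᵛₙ` for a large `n`, both sides of a tightness relation therefore become `T v` or `0`. The `T v`
need not be jointly faithful in a unital algebra that contains the `T f`, but they are in the
multiplier algebra of the C*-algebra `A` that the `T f` generate, and `A` embeds there. So the norm
of either universal algebra dominates that of the other on the *-algebra of the generators.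
-/

/-! ### Projections and joins -/

theorem isStarProjection_mul_star_self {B : Type*} [Semigroup B] [StarMul B] {a : B}
    (ha : IsPartialIsometry a) : IsStarProjection (a * star a) where
  isIdempotentElem := by
    have h : a * star a * a = a := ha
    rw [IsIdempotentElem, ← mul_assoc, h]
  isSelfAdjoint := .mul_star_self a

theorem projection_mul_eq_zero_of_sum_mul_eq_zero {B ι : Type*} [NonUnitalCStarAlgebra B]
    {s : Finset ι} {p : ι → B} {a : B} (hp : ∀ i ∈ s, IsStarProjection (p i))
    (h : (∑ i ∈ s, p i) * a = 0) {i : ι} (hi : i ∈ s) : p i * a = 0 := by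
  let _ := CStarAlgebra.spectralOrder B
  have _ := CStarAlgebra.spectralOrderedRing B
  have hmul : ∀ i ∈ s, star (p i * a) * (p i * a) = star a * (p i * a) := fun i hi => by
    rw [star_mul, (hp i hi).isSelfAdjoint.star_eq, mul_assoc, ← mul_assoc (p i),
      (hp i hi).isIdempotentElem.eq]
  have hsum : ∑ i ∈ s, star (p i * a) * (p i * a) = 0 := by
    rw [Finset.sum_congr rfl hmul, ← Finset.mul_sum, ← Finset.sum_mul, h, mul_zero]
  have hzero := (Finset.sum_eq_zero_iff_of_nonneg fun i _ => star_mul_self_nonneg (p i * a)).mp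
    hsum i hi
  exact (CStarRing.star_mul_self_eq_zero_iff _).mp hzero

namespace Semigroupoid

theorem joinList_map_eq_sum {B ι : Type*} [Ring B] (p : ι → B) {l : List ι}
    (h : l.Pairwise fun i j => p i * p j = 0) : joinList (l.map p) = (l.map p).sum := by
  induction l with
  | nil => rfl
  | cons i l ih =>
    rw [List.pairwise_cons] at h
    have hi : p i * (l.map p).sum = 0 := by
      rw [← List.sum_map_mul_left]
      exact List.sum_eq_zero (by simpa using h.1)
    simp [joinList, ih h.2, hi]

theorem prod_map_mul_eq_ite {B ι : Type*} [MonoidWithZero B] {p : ι → B} {c : ι → Prop}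
    [DecidablePred c] {t : B} {l : List ι} (h : ∀ i ∈ l, p i * t = if c i then t else 0) :
    (l.map p).prod * t = if ∀ i ∈ l, c i then t else 0 := by
  induction l with
  | nil => simp
  | cons i l ih =>
    rw [List.forall_mem_cons] at h
    rw [List.map_cons, List.prod_cons, mul_assoc, ih h.2]
    by_cases hi : c i <;> by_cases hl : ∀ j ∈ l, c j <;> simp_all

open scoped Classical in
theorem joinList_map_mul_eq_ite {B ι : Type*} [Ring B] {p : ι → B} {c : ι → Prop} {t : B}
    {l : List ι} (h : ∀ i ∈ l, p i * t = if c i then t else 0) :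
    joinList (l.map p) * t = if ∃ i ∈ l, c i then t else 0 := by
  induction l with
  | nil => simp [joinList]
  | cons i l ih =>
    rw [List.forall_mem_cons] at h
    simp only [List.map_cons, joinList, sub_mul, add_mul, mul_assoc, ih h.2, h.1,
      List.exists_mem_cons_iff]
    by_cases hi : c i <;> by_cases hl : ∃ j ∈ l, c j <;> simp [hi, hl, h.1]

/-! ### Divisibility of morphisms -/

theorem Divides.trans {S : Type u} [Semigroupoid S] {f g h : S} (hfg : Divides f g)
    (hgh : Divides g h) : Divides f h := by
  obtain rfl | ⟨a, ha, rfl⟩ := hfg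
  · exact hgh
  obtain rfl | ⟨b, hb, rfl⟩ := hgh
  · exact Or.inr ⟨a, ha, rfl⟩
  obtain ⟨_, hab, _, hfab, e⟩ := assoc f a b (Or.inr (Or.inl ⟨ha, hb⟩))
  exact Or.inr ⟨mul a b hab, hfab, e.symm⟩

end Semigroupoid

namespace Mor

open Semigroupoid

variable {C : Type u} [Category.{v} C]

theorem comp_id (f : Mor C) : f.comp (Mor.id f.src) rfl = f := by
  cases f; simp [comp, Mor.id]

theorem id_comp (f : Mor C) : (Mor.id f.rng).comp f rfl = f := by
  obtain ⟨x, y, f⟩ := f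
  change (⟨x, y, f ≫ 𝟙 y ≫ 𝟙 y⟩ : Mor C) = ⟨x, y, f⟩
  simp only [Category.comp_id]

theorem divides_comp (f g : Mor C) (h : f.src = g.rng) : Divides f (f.comp g h) :=
  Or.inr ⟨g, h, rfl⟩

theorem divides_iff {f g : Mor C} :
    Divides f g ↔ ∃ (h : Mor C) (hc : f.src = h.rng), f.comp h hc = g := by
  refine ⟨?_, Or.inr⟩
  rintro (rfl | h)
  · exact ⟨_, rfl, comp_id f⟩
  · exact h

theorem rng_eq_of_divides {f g : Mor C} (h : Divides f g) : f.rng = g.rng := by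
  obtain ⟨_, _, rfl⟩ := divides_iff.mp h
  rfl

theorem mem_rightSet_congr {f g : Mor C} (h : f.rng = g.rng) (a : Option (Mor C)) :
    f ∈ rightSet a ↔ g ∈ rightSet a := by
  cases a with
  | none => exact Iff.rfl
  | some a => exact Eq.congr_right h

theorem mem_cylinder_congr {F G : Finset (Option (Mor C))} {f g : Mor C} (h : f.rng = g.rng) :
    f ∈ cylinder F G ↔ g ∈ cylinder F G := by
  simp only [cylinder, Set.mem_ofPred_eq, mem_rightSet_congr h]

end Mor

namespace KGraph

open Semigroupoid

variable {k : ℕ} {C : Type u} [Category.{v} C] {Λ : KGraph k C}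

variable (Λ) in
theorem exists_divides_deg_eq (g : Mor C) {n : Fin k → ℕ} (hn : n ≤ Λ.deg g) :
    ∃ f, Divides f g ∧ Λ.deg f = n := by
  obtain ⟨⟨f, a⟩, ⟨hf, -, ha, rfl⟩, -⟩ := Λ.factorization g n (Λ.deg g - n)
    (add_tsub_cancel_of_le hn).symm
  exact ⟨f, Mor.divides_comp f a ha, hf⟩

theorem eq_of_intersects {f g : Mor C} (h : Intersects f g) (hd : Λ.deg f = Λ.deg g) : f = g := by
  obtain ⟨m, hf, hg⟩ := h
  obtain ⟨a, ha, rfl⟩ := Mor.divides_iff.mp hf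
  obtain ⟨b, hb, e⟩ := Mor.divides_iff.mp hg
  have hab : Λ.deg b = Λ.deg a := by
    have := congrArg Λ.deg e
    rw [Λ.deg_comp, Λ.deg_comp, hd] at this
    exact add_left_cancel this
  have huniq := (Λ.factorization (f.comp a ha) _ _ (Λ.deg_comp f a ha)).unique
    (y₁ := (f, a)) (y₂ := (g, b)) ⟨rfl, rfl, ha, rfl⟩ ⟨hd.symm, hab, hb, e⟩
  exact congrArg Prod.fst huniq

theorem divides_of_intersects {f g : Mor C} (h : Intersects f g) (hd : Λ.deg f ≤ Λ.deg g) :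
    Divides f g := by
  obtain ⟨m, hf, hg⟩ := h
  obtain ⟨f', hf', hd'⟩ := Λ.exists_divides_deg_eq g hd
  obtain rfl := eq_of_intersects ⟨m, hf, hf'.trans hg⟩ hd'.symm
  exact hf'

theorem NoSources.exists_intersects (hsrc : Λ.NoSources) (f : Mor C) (n : Fin k → ℕ) :
    ∃ h ∈ Λ.paths f.rng n, Intersects h f := by
  obtain ⟨g, hg, hn⟩ := hsrc f.src n
  obtain ⟨h, hh, hd⟩ := Λ.exists_divides_deg_eq (f.comp g hg.symm) (n := n) (by
    rw [Λ.deg_comp, hn]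
    exact le_add_self)
  exact ⟨h, ⟨(Mor.rng_eq_of_divides hh :), hd⟩, f.comp g hg.symm, hh, Mor.divides_comp f g hg.symm⟩

theorem NoSources.isCovering_paths (hsrc : Λ.NoSources) (x : C) (n : Fin k → ℕ) :
    IsCovering (Λ.paths x n) (cylinder {some (Mor.id x)} ∅) := by
  constructor
  · rintro f ⟨hf, -⟩
    refine ⟨fun g hg => ?_, by simp⟩
    rw [Finset.mem_singleton.mp hg]
    exact hf.symm
  · intro f hf
    obtain rfl : x = f.rng := hf.1 _ (Finset.mem_singleton_self _)
    exact hsrc.exists_intersects f n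

theorem exists_divides_iff_of_isCovering {F G : Finset (Option (Mor C))} {H : Finset (Mor C)}
    (hH : IsCovering (H : Set (Mor C)) (cylinder F G)) {μ : Mor C}
    (hμ : ∀ h ∈ H, Λ.deg h ≤ Λ.deg μ) : (∃ h ∈ H, Divides h μ) ↔ μ ∈ cylinder F G := by
  constructor
  · rintro ⟨h, hh, hdiv⟩
    exact (Mor.mem_cylinder_congr (Mor.rng_eq_of_divides hdiv)).mp (hH.1 hh)
  · intro hmem
    obtain ⟨h, hh, hi⟩ := hH.2 μ hmem
    exact ⟨h, hh, divides_of_intersects hi (hμ h hh)⟩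

end KGraph

/-! ### Tight representations satisfy the relations of the graph algebra -/

namespace Semigroupoid.IsRepresentation

variable {C : Type u} [Category.{v} C] {B : Type*} [CStarAlgebra B] {T : Mor C → B}

theorem map_comp (hT : IsRepresentation T) (f g : Mor C) (h : f.src = g.rng) :
    T (f.comp g h) = T f * T g :=
  (hT.map_mul f g h).symm

theorem isStarProjection_id (hT : IsRepresentation T) (x : C) :
    IsStarProjection (T (Mor.id x)) := by
  set e := T (Mor.id x)
  have hidem : e * e = e := by
    rw [← hT.map_comp _ _ rfl]
    exact congrArg T (Mor.comp_id (Mor.id x))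
  have hstar : star e = e * star e := calc
    star e = star (e * star e * e) := congrArg star (hT.partialIsometry _).symm
    _ = star e * (e * e) * star e := by simp only [hidem, star_mul, star_star, mul_assoc]
    _ = star e * e * (e * star e) := by simp only [mul_assoc]
    _ = e * star e := hT.initial_mul_final (Mor.id x) (Mor.id x) rfl
  exact ⟨hidem, IsSelfAdjoint.star_iff.mp (hstar ▸ .mul_star_self e)⟩

theorem star_mul_self (hT : IsRepresentation T) (f : Mor C) :
    star (T f) * T f = T (Mor.id f.src) := by
  have hid := hT.isStarProjection_id f.src
  have h := hT.initial_mul_final f (Mor.id f.src) rfl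
  rwa [hid.isSelfAdjoint.star_eq, hid.isIdempotentElem.eq, mul_assoc, ← hT.map_comp _ _ rfl,
    Mor.comp_id] at h

end Semigroupoid.IsRepresentation

namespace KGraph

open Semigroupoid

variable {k : ℕ} {C : Type u} [Category.{v} C] {Λ : KGraph k C}

theorem isKPFamily_of_isTight (hsrc : Λ.NoSources) {B : Type*} [CStarAlgebra B] {T : Mor C → B}
    (hT : IsTightRepresentation T) : Λ.IsKPFamily T where
  partialIsometry := hT.partialIsometry
  projection := hT.isStarProjection_id
  orthogonal x y hxy := hT.mul_eq_zero _ _ hxy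
  map_comp := hT.map_comp
  star_mul_self := hT.star_mul_self
  sum_final x n hfin := by
    have htight := hT.tight {some (Mor.id x)} ∅ hfin.toFinset
      (by simpa only [Set.Finite.coe_toFinset] using hsrc.isCovering_paths x n)
    have horth : hfin.toFinset.toList.Pairwise fun f g =>
        T f * star (T f) * (T g * star (T g)) = 0 := by
      refine (Finset.nodup_toList _).pairwise_of_forall_ne fun f hf g hg hne => ?_
      rw [Finset.mem_toList, Set.Finite.mem_toFinset] at hf hg
      exact hT.final_mul_final f g fun hi => hne (eq_of_intersects hi (hf.2.trans hg.2.symm))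
    rw [joinList_map_eq_sum _ horth, Finset.sum_map_toList] at htight
    have hprod : ∑ f ∈ hfin.toFinset, T f * star (T f) = T (Mor.id x) := by
      simpa [initialProj, hT.star_mul_self] using! htight
    exact hprod.symm

/-! ### Families that satisfy the relations of the graph algebra -/

namespace IsKPFamily

theorem map {A B : Type*} [NonUnitalCStarAlgebra A] [NonUnitalCStarAlgebra B] {T : Mor C → A}
    (hT : Λ.IsKPFamily T) (φ : A →⋆ₙₐ[ℂ] B) : Λ.IsKPFamily fun f => φ (T f) where
  partialIsometry f := by
    have h : T f * star (T f) * T f = T f := hT.partialIsometry f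
    rw [IsPartialIsometry, ← map_star, ← map_mul, ← map_mul, h]
  projection x := (hT.projection x).map φ
  orthogonal x y h := by rw [← map_mul, hT.orthogonal x y h, map_zero]
  map_comp f g h := by rw [hT.map_comp f g h, map_mul]
  star_mul_self f := by rw [← map_star, ← map_mul, hT.star_mul_self]
  sum_final x n h := by simp only [← map_star, ← map_mul, ← map_sum, ← hT.sum_final x n h]

section NonUnital

variable {B : Type*} [NonUnitalCStarAlgebra B] {T : Mor C → B}

theorem mul_id (hT : Λ.IsKPFamily T) (f : Mor C) : T f * T (Mor.id f.src) = T f := by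
  rw [← hT.map_comp _ _ rfl, Mor.comp_id]

theorem id_mul (hT : Λ.IsKPFamily T) (f : Mor C) : T (Mor.id f.rng) * T f = T f := by
  rw [← hT.map_comp _ _ rfl, Mor.id_comp]

theorem id_mul_star (hT : Λ.IsKPFamily T) (f : Mor C) :
    T (Mor.id f.src) * star (T f) = star (T f) := by
  simpa only [star_mul, (hT.projection _).isSelfAdjoint.star_eq] using congrArg star (hT.mul_id f)

theorem star_mul_id (hT : Λ.IsKPFamily T) (f : Mor C) :
    star (T f) * T (Mor.id f.rng) = star (T f) := by
  simpa only [star_mul, (hT.projection _).isSelfAdjoint.star_eq] using congrArg star (hT.id_mul f)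

theorem mul_eq_zero (hT : Λ.IsKPFamily T) {f g : Mor C} (h : f.src ≠ g.rng) : T f * T g = 0 := by
  rw [← hT.mul_id f, ← hT.id_mul g, mul_assoc, ← mul_assoc (T (Mor.id _)), hT.orthogonal _ _ h,
    zero_mul, mul_zero]

theorem id_mul_final (hT : Λ.IsKPFamily T) (f : Mor C) :
    T (Mor.id f.rng) * (T f * star (T f)) = T f * star (T f) := by
  rw [← mul_assoc, hT.id_mul]

theorem final_mul_id (hT : Λ.IsKPFamily T) (f : Mor C) :
    T f * star (T f) * T (Mor.id f.rng) = T f * star (T f) := by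
  rw [mul_assoc, hT.star_mul_id]

theorem id_eq_final (hT : Λ.IsKPFamily T) (x : C) :
    T (Mor.id x) = T (Mor.id x) * star (T (Mor.id x)) := by
  rw [(hT.projection x).isSelfAdjoint.star_eq, (hT.projection x).isIdempotentElem.eq]

theorem final_mul_final_of_divides (hT : Λ.IsKPFamily T) {f g : Mor C} (h : Divides f g) :
    T f * star (T f) * (T g * star (T g)) = T g * star (T g) := by
  obtain ⟨a, ha, rfl⟩ := Mor.divides_iff.mp h
  have hf : T f * star (T f) * T f = T f := hT.partialIsometry f
  rw [hT.map_comp, ← mul_assoc, ← mul_assoc _ (T f), hf]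

theorem final_mul_final_of_rng_ne (hT : Λ.IsKPFamily T) {f g : Mor C} (h : f.rng ≠ g.rng) :
    T f * star (T f) * (T g * star (T g)) = 0 := by
  rw [← hT.final_mul_id f, ← hT.id_mul_final g, mul_assoc, ← mul_assoc (T (Mor.id f.rng)),
    hT.orthogonal _ _ h, zero_mul, mul_zero]

theorem final_mul_final_of_deg_eq (hT : Λ.IsKPFamily T) (hfin : Λ.RowFinite) {f g : Mor C}
    (hd : Λ.deg f = Λ.deg g) (hne : f ≠ g) : T f * star (T f) * (T g * star (T g)) = 0 := by
  classical
  by_cases hr : f.rng = g.rng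
  · let s := (hfin g.rng (Λ.deg g)).toFinset
    have hg : g ∈ s := (Set.Finite.mem_toFinset _).mpr ⟨rfl, rfl⟩
    have hf : f ∈ s.erase g :=
      Finset.mem_erase.mpr ⟨hne, (Set.Finite.mem_toFinset _).mpr ⟨hr, hd⟩⟩
    have hproj (f : Mor C) := isStarProjection_mul_star_self (hT.partialIsometry f)
    refine projection_mul_eq_zero_of_sum_mul_eq_zero (p := fun f => T f * star (T f))
      (fun f _ => hproj f) ?_ hf
    rw [Finset.sum_erase_eq_sub hg, ← hT.sum_final, sub_mul, hT.id_mul_final,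
      (hproj g).isIdempotentElem.eq, sub_self]
  · exact hT.final_mul_final_of_rng_ne hr

theorem final_mul_final_of_not_divides (hT : Λ.IsKPFamily T) (hfin : Λ.RowFinite) {f μ : Mor C}
    (hd : Λ.deg f ≤ Λ.deg μ) (h : ¬ Divides f μ) :
    T f * star (T f) * (T μ * star (T μ)) = 0 := by
  obtain ⟨g, hg, hdg⟩ := Λ.exists_divides_deg_eq μ hd
  have hne : f ≠ g := by
    rintro rfl
    exact h hg
  rw [← hT.final_mul_final_of_divides hg, ← mul_assoc,
    hT.final_mul_final_of_deg_eq hfin hdg.symm hne, zero_mul]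

open scoped Classical in
theorem final_mul_final_of_deg_le (hT : Λ.IsKPFamily T) (hfin : Λ.RowFinite) {f μ : Mor C}
    (hd : Λ.deg f ≤ Λ.deg μ) :
    T f * star (T f) * (T μ * star (T μ)) = if Divides f μ then T μ * star (T μ) else 0 := by
  split_ifs with h
  · exact hT.final_mul_final_of_divides h
  · exact hT.final_mul_final_of_not_divides hfin hd h

open scoped Classical in
theorem final_mul_final_eq_sum (hT : Λ.IsKPFamily T) (hfin : Λ.RowFinite) (f g : Mor C) :
    T f * star (T f) * (T g * star (T g)) =
      ∑ μ ∈ (hfin g.rng (Λ.deg f ⊔ Λ.deg g)).toFinset with Divides g μ ∧ Divides f μ,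
        T μ * star (T μ) := by
  rw [← hT.final_mul_id g, hT.sum_final _ (Λ.deg f ⊔ Λ.deg g) (hfin _ _), Finset.mul_sum,
    Finset.mul_sum, Finset.sum_filter]
  refine Finset.sum_congr rfl fun μ hμ => ?_
  have hd : Λ.deg μ = Λ.deg f ⊔ Λ.deg g := ((Set.Finite.mem_toFinset _).mp hμ).2
  rw [hT.final_mul_final_of_deg_le hfin (hd ▸ le_sup_right), mul_ite, mul_zero,
    hT.final_mul_final_of_deg_le hfin (hd ▸ le_sup_left), ite_and]

theorem commute_final_final (hT : Λ.IsKPFamily T) (hfin : Λ.RowFinite) (f g : Mor C) :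
    Commute (T f * star (T f)) (T g * star (T g)) := by
  classical
  rw [IsSelfAdjoint.commute_iff (.mul_star_self _) (.mul_star_self _),
    hT.final_mul_final_eq_sum hfin]
  exact isSelfAdjoint_sum _ fun μ _ => .mul_star_self (T μ)

theorem final_mul_final_of_not_intersects (hT : Λ.IsKPFamily T) (hfin : Λ.RowFinite) {f g : Mor C}
    (h : ¬ Intersects f g) : T f * star (T f) * (T g * star (T g)) = 0 := by
  classical
  rw [hT.final_mul_final_eq_sum hfin, Finset.filter_false_of_mem, Finset.sum_empty]
  exact fun μ _ hμ => h ⟨μ, hμ.2, hμ.1⟩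

end NonUnital

/-! ### Nondegenerate families are tight representations -/

section Unital

variable {B : Type*} [CStarAlgebra B] {T : Mor C → B}

theorem isRepresentation (hT : Λ.IsKPFamily T) (hfin : Λ.RowFinite) : IsRepresentation T where
  partialIsometry := hT.partialIsometry
  map_mul f g h := (hT.map_comp f g h).symm
  mul_eq_zero f g h := hT.mul_eq_zero h
  commute_initial_initial f g := by
    rw [hT.star_mul_self, hT.star_mul_self, hT.id_eq_final f.src, hT.id_eq_final g.src]
    exact hT.commute_final_final hfin _ _
  commute_initial_final f g := by
    rw [hT.star_mul_self, hT.id_eq_final f.src]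
    exact hT.commute_final_final hfin _ _
  commute_final_final := hT.commute_final_final hfin
  final_mul_final f g h := hT.final_mul_final_of_not_intersects hfin h
  initial_mul_final f g h := by
    have h : f.src = g.rng := h
    rw [hT.star_mul_self, h, hT.id_mul_final]

open scoped Classical in
theorem initialProj_mul_id (hT : Λ.IsKPFamily T) (f : Option (Mor C)) (x : C) :
    initialProj T f * T (Mor.id x) = if Mor.id x ∈ rightSet f then T (Mor.id x) else 0 := by
  cases f with
  | none => simp [initialProj, rightSet]
  | some f =>
    rw [initialProj, hT.star_mul_self]
    split_ifs with h
    · have h : f.src = x := h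
      rw [h, (hT.projection x).isIdempotentElem.eq]
    · exact hT.orthogonal _ _ h

open scoped Classical in
theorem prod_initialProj_mul_id (hT : Λ.IsKPFamily T) (F G : Finset (Option (Mor C))) (x : C) :
    (F.toList.map fun f => initialProj T f).prod *
        (G.toList.map fun g => 1 - initialProj T g).prod * T (Mor.id x) =
      if Mor.id x ∈ cylinder F G then T (Mor.id x) else 0 := by
  have hG : ∀ g ∈ G.toList, (1 - initialProj T g) * T (Mor.id x) =
      if Mor.id x ∉ rightSet g then T (Mor.id x) else 0 := fun g _ => by
    rw [sub_mul, one_mul, hT.initialProj_mul_id]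
    split_ifs <;> simp
  rw [mul_assoc, prod_map_mul_eq_ite hG, mul_ite, mul_zero,
    prod_map_mul_eq_ite fun f _ => hT.initialProj_mul_id f x, ← ite_and]
  simp only [Finset.mem_toList, and_comm]
  exact if_congr Iff.rfl rfl rfl

open scoped Classical in
theorem joinList_mul_id (hT : Λ.IsKPFamily T) (hfin : Λ.RowFinite)
    {F G : Finset (Option (Mor C))} {H : Finset (Mor C)}
    (hH : IsCovering (H : Set (Mor C)) (cylinder F G)) (x : C) :
    joinList (H.toList.map fun h => T h * star (T h)) * T (Mor.id x) =
      if Mor.id x ∈ cylinder F G then T (Mor.id x) else 0 := by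
  have hterm : ∀ μ ∈ (hfin x (H.sup Λ.deg)).toFinset,
      joinList (H.toList.map fun h => T h * star (T h)) * (T μ * star (T μ)) =
        if Mor.id x ∈ cylinder F G then T μ * star (T μ) else 0 := fun μ hμ => by
    obtain ⟨rfl, hd⟩ := (Set.Finite.mem_toFinset _).mp hμ
    have hdeg : ∀ h ∈ H, Λ.deg h ≤ Λ.deg μ := fun h hh => hd ▸ Finset.le_sup (f := Λ.deg) hh
    rw [joinList_map_mul_eq_ite fun h hh =>
      hT.final_mul_final_of_deg_le hfin (hdeg h (Finset.mem_toList.mp hh))]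
    simp only [Finset.mem_toList, exists_divides_iff_of_isCovering hH hdeg]
    exact if_congr (Mor.mem_cylinder_congr rfl) rfl rfl
  rw [hT.sum_final x _ (hfin x (H.sup Λ.deg)), Finset.mul_sum, Finset.sum_congr rfl hterm]
  split_ifs <;> simp only [Finset.sum_const_zero]

end Unital

end IsKPFamily

/-- A family of elements indexed by morphisms is nondegenerate if no nonzero element of the algebra
is annihilated by right multiplication with all members at identity morphisms. -/
def IsNondegenerate {B : Type*} [Mul B] [Zero B] (T : Mor C → B) : Prop :=
  ∀ a : B, (∀ x, a * T (Mor.id x) = 0) → a = 0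

theorem IsKPFamily.isTightRepresentation {B : Type*} [CStarAlgebra B] {T : Mor C → B}
    (hT : Λ.IsKPFamily T) (hfin : Λ.RowFinite) (hnd : IsNondegenerate T) :
    IsTightRepresentation T where
  toIsRepresentation := hT.isRepresentation hfin
  tight F G H hH := by
    classical
    refine sub_eq_zero.mp (hnd _ fun x => ?_)
    rw [sub_mul, hT.joinList_mul_id hfin hH, hT.prod_initialProj_mul_id, sub_self]

end KGraph

/-! ### C*-algebras generated by a family -/

section Generation

open scoped CStarAlgebra

variable {A B ι : Type*} [NonUnitalCStarAlgebra A] [NonUnitalCStarAlgebra B]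

theorem closedAdjoin_le {s : Set B} {K : NonUnitalStarSubalgebra ℂ B} (hK : IsClosed (K : Set B))
    (hs : s ⊆ K) : closedAdjoin s ≤ K :=
  NonUnitalStarSubalgebra.topologicalClosure_minimal _ (NonUnitalStarAlgebra.adjoin_le hs) hK

noncomputable instance (s : Set B) : NonUnitalCStarAlgebra (closedAdjoin s) :=
  NonUnitalStarSubalgebra.nonUnitalCStarAlgebra (closedAdjoin s)
    (h_closed := isClosed_closedAdjoin s)

theorem closedAdjoin_range_subtype_eq_top (T : ι → B) :
    closedAdjoin (Set.range fun i =>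
      (⟨T i, subset_closedAdjoin _ ⟨i, rfl⟩⟩ : closedAdjoin (Set.range T))) = ⊤ := by
  set K := closedAdjoin (Set.range fun i =>
    (⟨T i, subset_closedAdjoin _ ⟨i, rfl⟩⟩ : closedAdjoin (Set.range T)))
  have hK : IsClosed (K : Set (closedAdjoin (Set.range T))) := isClosed_closedAdjoin _
  have hclosed : IsClosed (K.map (NonUnitalStarSubalgebraClass.subtype _) : Set B) :=
    (isClosed_closedAdjoin (Set.range T)).isClosedEmbedding_subtypeVal.isClosedMap _ hK
  refine NonUnitalStarAlgebra.eq_top_iff.mpr fun a => ?_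
  have hgen : Set.range T ⊆ K.map (NonUnitalStarSubalgebraClass.subtype _) := by
    rintro _ ⟨i, rfl⟩
    exact ⟨_, subset_closedAdjoin _ ⟨i, rfl⟩, rfl⟩
  obtain ⟨b, hb, e⟩ := closedAdjoin_le hclosed hgen a.2
  exact Subtype.ext e ▸ hb

theorem map_mem_of_closedAdjoin_eq_top {T : ι → A} (hT : closedAdjoin (Set.range T) = ⊤)
    (φ : A →⋆ₙₐ[ℂ] B) {K : NonUnitalStarSubalgebra ℂ B} (hK : IsClosed (K : Set B))
    (h : ∀ i, φ (T i) ∈ K) (a : A) : φ a ∈ K :=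
  closedAdjoin_le (K := K.comap φ) (hK.preimage (map_continuous φ)) (Set.range_subset_iff.mpr h)
    (hT ▸ NonUnitalStarAlgebra.mem_top : a ∈ closedAdjoin (Set.range T))

theorem surjective_of_closedAdjoin_eq_top {T : ι → B} (hT : closedAdjoin (Set.range T) = ⊤)
    {φ : A →⋆ₙₐ[ℂ] B} (hφ : Function.Injective φ) (h : ∀ i, ∃ a, φ a = T i) :
    Function.Surjective φ :=
  map_mem_of_closedAdjoin_eq_top hT (NonUnitalStarAlgHom.id ℂ B)
    (K := NonUnitalStarAlgHom.range φ)
    (NonUnitalStarAlgHom.isometry φ hφ).isClosedEmbedding.isClosed_range h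

theorem mul_map_eq_zero_of_closedAdjoin_eq_top {T : ι → A} (hT : closedAdjoin (Set.range T) = ⊤)
    (φ : A →⋆ₙₐ[ℂ] B) {d : B} (h : ∀ i, d * φ (T i) = 0) (hstar : ∀ i, d * φ (star (T i)) = 0)
    (a : A) : d * φ a = 0 := by
  let K : NonUnitalStarSubalgebra ℂ B :=
    { carrier := {b | d * b = 0 ∧ d * star b = 0}
      add_mem' := fun hb hc => by simp [mul_add, hb.1, hb.2, hc.1, hc.2]
      zero_mem' := by simp
      mul_mem' := fun hb hc => by simp [← mul_assoc, hb.1, hc.2]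
      smul_mem' := fun c b hb => by simp [mul_smul_comm, hb.1, hb.2]
      star_mem' := fun hb => ⟨hb.2, by simpa using hb.1⟩ }
  have hK : IsClosed (K : Set B) :=
    (isClosed_eq (by fun_prop) continuous_const).inter
      (isClosed_eq (by fun_prop) continuous_const)
  exact (map_mem_of_closedAdjoin_eq_top hT φ hK
    (fun i => ⟨h i, by simpa only [map_star] using hstar i⟩) a).1

/-- The homomorphism into the bounded families whose components are given homomorphisms. -/
noncomputable def lpInftyLift {B : ι → Type*} [∀ i, NonUnitalCStarAlgebra (B i)]
    (φ : ∀ i, A →⋆ₙₐ[ℂ] B i) : A →⋆ₙₐ[ℂ] lp B ∞ where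
  toFun a := ⟨fun i => φ i a, memℓp_infty ⟨‖a‖, by
    rintro _ ⟨i, rfl⟩
    exact NonUnitalStarAlgHom.norm_apply_le (φ i) a⟩⟩
  map_smul' c a := lp.ext (funext fun i => map_smul (φ i) c a)
  map_zero' := lp.ext (funext fun i => map_zero (φ i))
  map_add' a b := lp.ext (funext fun i => map_add (φ i) a b)
  map_mul' a b := lp.ext (funext fun i => map_mul (φ i) a b)
  map_star' a := lp.ext (funext fun i => map_star (φ i) a)

end Generation

/-! ### Embedding into the multiplier algebra -/

section Multiplier

open scoped MultiplierAlgebra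

variable {A : Type*} [NonUnitalCStarAlgebra A]

theorem multiplier_eq_zero_of_mul_coe_eq_zero {d : 𝓜(ℂ, A)}
    (h : ∀ a : A, d * (a : 𝓜(ℂ, A)) = 0) : d = 0 := by
  have hsnd (b : A) : d.snd b = 0 := by
    have hmul (a : A) : d.snd b * a = 0 := congrArg (fun e : 𝓜(ℂ, A) => e.snd b) (h a)
    exact CStarRing.mul_star_self_eq_zero_iff _ |>.mp (hmul _)
  rw [← norm_eq_zero, ← DoubleCentralizer.norm_snd, norm_eq_zero]
  exact ContinuousLinearMap.ext hsnd

theorem multiplier_coeHom_injective :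
    Function.Injective (DoubleCentralizer.coeHom : A →⋆ₙₐ[ℂ] 𝓜(ℂ, A)) := by
  refine (injective_iff_map_eq_zero _).mpr fun a ha => ?_
  have hmul (b : A) : a * b = 0 := congrArg (fun e : 𝓜(ℂ, A) => e.fst b) ha
  exact (CStarRing.mul_star_self_eq_zero_iff a).mp (hmul _)

end Multiplier

/-! ### The isomorphism -/

theorem SemigroupoidAlgebra.closedAdjoin_range_gen (S : Type u) [Semigroupoid S] :
    closedAdjoin (Set.range (SemigroupoidAlgebra.gen.{u, w} S)) = ⊤ :=
  closedAdjoin_range_subtype_eq_top (universalTight.{u, w} S)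

namespace KGraph

open Semigroupoid
open scoped CStarAlgebra MultiplierAlgebra

variable {k : ℕ} {C : Type u} [Category.{v} C] {Λ : KGraph k C}

theorem IsKPFamily.isTightRepresentation_coeHom {A : Type*} [NonUnitalCStarAlgebra A]
    {T : Mor C → A} (hT : Λ.IsKPFamily T) (hfin : Λ.RowFinite)
    (hgen : closedAdjoin (Set.range T) = ⊤) :
    IsTightRepresentation fun f => (DoubleCentralizer.coeHom (T f) : 𝓜(ℂ, A)) := by
  have hM := hT.map (DoubleCentralizer.coeHom : A →⋆ₙₐ[ℂ] 𝓜(ℂ, A))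
  refine hM.isTightRepresentation hfin fun d hd => ?_
  refine multiplier_eq_zero_of_mul_coe_eq_zero
    (mul_map_eq_zero_of_closedAdjoin_eq_top hgen DoubleCentralizer.coeHom (fun f => ?_) fun f => ?_)
  · rw [← hM.id_mul, ← mul_assoc, hd, zero_mul]
  · rw [map_star, ← hM.id_mul_star, ← mul_assoc, hd, zero_mul]

theorem closedAdjoin_range_gen : closedAdjoin (Set.range (gen.{u, v, w} Λ)) = ⊤ :=
  closedAdjoin_range_subtype_eq_top (kpFamily.{u, v, w} Λ)

/-- A tight representation of a `k`-graph without sources, regarded as a family that satisfies the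
relations of the graph algebra. -/
noncomputable def KPFamily.ofTightRep (hsrc : Λ.NoSources) (i : TightRep.{max u v, w} (Mor C)) :
    KPFamily.{u, v, w} Λ where
  carrier := i.carrier
  toFun := i.toFun
  isKP := isKPFamily_of_isTight hsrc i.isTight

/-- The canonical homomorphism from the graph algebra to the universal unital C*-algebra for tight
representations. -/
noncomputable def toUnital (hsrc : Λ.NoSources) :
    GraphAlgebra.{u, v, w} Λ →⋆ₙₐ[ℂ] UnitalSemigroupoidAlgebra.{max u v, w} (Mor C) :=
  NonUnitalStarAlgHom.codRestrict (lpInftyLift fun i => Λ.evalKP (KPFamily.ofTightRep hsrc i))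
    (tightSubalgebra.{max u v, w} (Mor C)).toNonUnitalStarSubalgebra
    (map_mem_of_closedAdjoin_eq_top closedAdjoin_range_gen _
      (StarSubalgebra.isClosed_topologicalClosure _) fun f =>
        (universalTight.{max u v, w} (Mor C) f).2)

theorem toUnital_gen (hsrc : Λ.NoSources) (f : Mor C) :
    toUnital hsrc (gen.{u, v, w} Λ f) = universalTight.{max u v, w} (Mor C) f := rfl

/-- The canonical homomorphism from the graph algebra to the semigroupoid C*-algebra. -/
noncomputable def toSemigroupoidAlgebra (hsrc : Λ.NoSources) :
    GraphAlgebra.{u, v, w} Λ →⋆ₙₐ[ℂ] SemigroupoidAlgebra.{max u v, w} (Mor C) :=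
  NonUnitalStarAlgHom.codRestrict (toUnital hsrc) (semigroupoidSubalgebra.{max u v, w} (Mor C))
    (map_mem_of_closedAdjoin_eq_top closedAdjoin_range_gen _ (isClosed_closedAdjoin _) fun f =>
      subset_closedAdjoin _ ⟨f, rfl⟩)

theorem toSemigroupoidAlgebra_gen (hsrc : Λ.NoSources) (f : Mor C) :
    toSemigroupoidAlgebra hsrc (gen.{u, v, w} Λ f) =
      SemigroupoidAlgebra.gen.{max u v, w} (Mor C) f := rfl

theorem map_eq_zero_of_toUnital_eq_zero (hsrc : Λ.NoSources) {B : Type (max u v w)}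
    [CStarAlgebra B] (φ : GraphAlgebra.{u, v, w} Λ →⋆ₙₐ[ℂ] B)
    (hφ : IsTightRepresentation fun f => φ (gen.{u, v, w} Λ f)) {x : GraphAlgebra.{u, v, w} Λ}
    (hx : toUnital hsrc x = 0) : φ x = 0 := by
  obtain ⟨ψ, hψ, -⟩ := existsUnique_lift_tight.{max u v, w} (Mor C) hφ
  have hcomp : ψ.toNonUnitalStarAlgHom.comp (toUnital hsrc) = φ :=
    (Λ.existsUnique_lift_KP ((gen_isKP.{u, v, w} Λ).map φ)).unique
      (fun f => (congrArg ψ (toUnital_gen hsrc f)).trans (hψ f)) fun _ => rfl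
  calc
    φ x = ψ (toUnital hsrc x) := (DFunLike.congr_fun hcomp x).symm
    _ = 0 := by rw [hx, map_zero]

theorem toUnital_injective (hfin : Λ.RowFinite) (hsrc : Λ.NoSources) :
    Function.Injective (toUnital.{u, v, w} hsrc) := by
  refine (injective_iff_map_eq_zero _).mpr fun x hx => evalKP_ext Λ fun i => ?_
  let φ : GraphAlgebra.{u, v, w} Λ →⋆ₙₐ[ℂ] closedAdjoin (Set.range i.toFun) :=
    NonUnitalStarAlgHom.codRestrict (Λ.evalKP i) _
      (map_mem_of_closedAdjoin_eq_top closedAdjoin_range_gen _ (isClosed_closedAdjoin _) fun f =>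
        subset_closedAdjoin _ ⟨f, rfl⟩)
  have htight := ((gen_isKP.{u, v, w} Λ).map φ).isTightRepresentation_coeHom hfin
    (closedAdjoin_range_subtype_eq_top i.toFun)
  have hzero : DoubleCentralizer.coeHom (𝕜 := ℂ) (φ x) = 0 :=
    map_eq_zero_of_toUnital_eq_zero hsrc (DoubleCentralizer.coeHom.comp φ) htight hx
  have hφ : φ x = 0 := multiplier_coeHom_injective (hzero.trans (map_zero _).symm)
  exact (congrArg Subtype.val hφ).trans (map_zero (Λ.evalKP i)).symm

theorem toSemigroupoidAlgebra_bijective (hfin : Λ.RowFinite) (hsrc : Λ.NoSources) :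
    Function.Bijective (toSemigroupoidAlgebra.{u, v, w} hsrc) := by
  have hinj : Function.Injective (toSemigroupoidAlgebra.{u, v, w} hsrc) := fun _ _ h =>
    toUnital_injective hfin hsrc (congrArg Subtype.val h)
  exact ⟨hinj, surjective_of_closedAdjoin_eq_top
    (SemigroupoidAlgebra.closedAdjoin_range_gen.{max u v, w} (Mor C)) hinj
    fun f => ⟨gen Λ f, toSemigroupoidAlgebra_gen hsrc f⟩⟩

/-- The canonical isomorphism from the graph algebra to the semigroupoid C*-algebra of the
underlying category. -/
noncomputable def equivSemigroupoidAlgebra (hfin : Λ.RowFinite) (hsrc : Λ.NoSources) :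
    GraphAlgebra.{u, v, w} Λ ≃⋆ₐ[ℂ] SemigroupoidAlgebra.{max u v, w} (Mor C) :=
  StarAlgEquiv.ofBijective (toSemigroupoidAlgebra.{u, v, w} hsrc)
    (toSemigroupoidAlgebra_bijective hfin hsrc)

theorem equivSemigroupoidAlgebra_gen (hfin : Λ.RowFinite) (hsrc : Λ.NoSources) (f : Mor C) :
    equivSemigroupoidAlgebra hfin hsrc (gen.{u, v, w} Λ f) =
      SemigroupoidAlgebra.gen.{max u v, w} (Mor C) f :=
  toSemigroupoidAlgebra_gen hsrc f

end KGraph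

theorem theorem8p7 {C : Type u} [Category.{v} C] {k : ℕ} (Λ : KGraph k C)
    (hfin : Λ.RowFinite) (hsrc : Λ.NoSources) :
    (∃ Φ : KGraph.GraphAlgebra.{u, v, w} Λ ≃⋆ₐ[ℂ] SemigroupoidAlgebra.{max u v, w} (Mor C),
      ∀ f : Mor C, Φ (KGraph.gen.{u, v, w} Λ f) = SemigroupoidAlgebra.gen.{max u v, w} (Mor C) f) ∧
    ∀ (l : ℕ) (Λ' : KGraph l C), Λ'.RowFinite → Λ'.NoSources →
      ∃ Ψ : KGraph.GraphAlgebra.{u, v, w} Λ ≃⋆ₐ[ℂ] KGraph.GraphAlgebra.{u, v, w} Λ',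
        ∀ f : Mor C, Ψ (KGraph.gen.{u, v, w} Λ f) = KGraph.gen.{u, v, w} Λ' f := by
  let Φ := KGraph.equivSemigroupoidAlgebra.{u, v, w} hfin hsrc
  refine ⟨⟨Φ, KGraph.equivSemigroupoidAlgebra_gen hfin hsrc⟩, fun l Λ' hfin' hsrc' => ?_⟩
  let Φ' := KGraph.equivSemigroupoidAlgebra.{u, v, w} hfin' hsrc'
  refine ⟨Φ.trans Φ'.symm, fun f => ?_⟩
  rw [StarAlgEquiv.trans_apply, KGraph.equivSemigroupoidAlgebra_gen,
    ← KGraph.equivSemigroupoidAlgebra_gen hfin' hsrc', StarAlgEquiv.symm_apply_apply]
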